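/- Fix a positive integer $k$. A $k$-graph is a small category $\Lambda$ with a degree functor $d:\Lambda\to\mathbb N^k$ such that every morphism $\lambda$ with $d(\lambda)=m+n$ factors uniquely as $\lambda=\mu\circ\nu$ with $d(\mu)=m$, $d(\nu)=n$; all $k$-graphs are assumed nonempty, connected, row-finite and without sources (i.e. the set $v\Lambda^n$ of morphisms of degree $n$ with range $v$ is finite and nonempty for every object $v$ and every $n\in\mathbb N^k$). Morphisms of $k$-graphs are degree-preserving functors. Write $\Lambda v$ and $v\Lambda$ for the sets of morphisms with source $v$ and with range $v$. A covering of $\Lambda$ is a pair $(\Omega,\alpha)$ of a $k$-graph $\Omega$ and a morphism $\alpha:\Omega\to\Lambda$ that maps $\Omega v$ bijectively onto $\Lambda\alpha(v)$ and $v\Omega$ bijectively onto $\alpha(v)\Lambda$ for every object $v$ of $\Omega$. It is universal if for every covering $(\Sigma,\beta)$ of $\Lambda$ there is a morphism $\phi:\Omega\to\Sigma$ with $\beta\circ\phi=\alpha$. A representation $k$-graph for $\Lambda$ is a pair $(\Delta,\alpha)$ of a $k$-graph $\Delta$ and a morphism $\alpha:\Delta\to\Lambda$ such that, for every object $v$ of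 $\Delta$, $\alpha$ maps $\Delta v$ bijectively onto $\Lambda\alpha(v)$, and $v\Delta^n$ is a singleton for every $n\in\mathbb N^k$. These are the objects of a category $\mathrm{RG}(\Lambda)$, in which a morphism $(\Delta,\alpha)\to(\Sigma,\beta)$ is a morphism $\phi:\Delta\to\Sigma$ of $k$-graphs with $\beta\circ\phi=\alpha$. A walk in $\Delta$ is a nonempty sequence of composable edges, each of which is a morphism $\delta$ of $\Delta$ or the formal reverse $\delta^*$ of a non-identity morphism $\delta$; $\mathrm{Walk}_u(\Delta)$ is the set of walks starting in $u$. For an object $(\Delta,\alpha)$ of $\mathrm{RG}(\Lambda)$ and objects $u,v$ of $\Delta$, let $u\sim v$ mean $\alpha(\mathrm{Walk}_u(\Delta))=\alpha(\mathrm{Walk}_v(\Delta))$; for morphisms, let $\delta\sim\delta'$ mean that $s(\delta)\sim s(\delta')$ and $\alpha(\delta)=\alpha(\delta')$. The quotient $(\Delta_\sim,\alpha_\sim)$ is the representation $k$-graph for $\Lambda$ whose objects and morphisms are the $\sim$-classes of those of $\Delta$, with source, range, degree, identities and $\alpha_\sim$ induced from $\Delta$ and $\alpha$, and with composition $[\delta'']\circ[\delta']=[\delta''\circ\delta']$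 for representatives such that $s(\delta'')=r(\delta')$. **Theorem.** Let $\Lambda$ be a $k$-graph and $C$ a connected component of the category $\mathrm{RG}(\Lambda)$. Choose an object $(\Delta,\alpha)$ of $C$ and a universal covering $(\Omega,\tau)$ of $\Delta$ (such choices exist), and set $(\Omega_C,\zeta_C)=(\Omega,\alpha\circ\tau)$ and $(\Gamma_C,\xi_C)=((\Omega_C)_\sim,(\zeta_C)_\sim)$. Then, for every such choice, $(\Omega_C,\zeta_C)$ and $(\Gamma_C,\xi_C)$ are objects of $C$, and $(\Gamma_C,\xi_C)$ is an attracting object of $C$: for every object $Y$ of $C$ there is a morphism $Y\to(\Gamma_C,\xi_C)$. Consequently the objects of $C$ are precisely the representation $k$-graphs $(\Sigma,\xi_C\circ\eta)$ where $(\Sigma,\eta)$ is a covering of $\Gamma_C$. -/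

import Mathlib

open CategoryTheory

universe u

namespace HRG

/-! ### Morphisms of a small category as a single set -/

/-- A morphism of a category together with its source and its target: an element of
`Λ`, when a category is regarded as a tuple `(Λᵒᵇ, Λ, r, s)`. -/
@[ext]
structure Arr (V : Type u) [SmallCategory V] where
  src : V
  tgt : V
  hom : src ⟶ tgt

/-- `f` is an identity morphism. -/
def Arr.IsId {V : Type u} [SmallCategory V] (f : Arr V) : Prop := ∃ v : V, f = ⟨v, v, 𝟙 v⟩

/-! ### `k`-graphs -/

/-- A `k`-graph: a small category with a degree functor to `ℕ^k` which has the factorisation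
property. As usual here, `k`-graphs are moreover nonempty, connected, row-finite and without
sources. The categorical composite `μ ∘ ν` is written `ν ≫ μ` in Mathlib. -/
structure KGraph (k : ℕ) where
  /-- the vertices -/
  Vert : Type u
  [cat : SmallCategory Vert]
  /-- the degree map -/
  deg : ∀ {v w : Vert}, (v ⟶ w) → (Fin k → ℕ)
  deg_id : ∀ v : Vert, deg (𝟙 v) = 0
  deg_comp : ∀ {v w x : Vert} (f : v ⟶ w) (g : w ⟶ x), deg (f ≫ g) = deg f + deg g
  /-- if `d(λ) = m + n` then there are unique `μ`, `ν` with `d(μ) = m`, `d(ν) = n` and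
  `λ = μ ∘ ν` -/
  factor : ∀ {v w : Vert} (f : v ⟶ w) (m n : Fin k → ℕ), deg f = m + n →
    ∃! p : (Σ x : Vert, (v ⟶ x) × (x ⟶ w)),
      deg p.2.2 = m ∧ deg p.2.1 = n ∧ p.2.1 ≫ p.2.2 = f
  nonempty : Nonempty Vert
  connected : ∀ v w : Vert, Zigzag v w
  rowFinite : ∀ (v : Vert) (n : Fin k → ℕ), {f : Arr Vert | f.tgt = v ∧ deg f.hom = n}.Finite
  noSources : ∀ (v : Vert) (n : Fin k → ℕ), {f : Arr Vert | f.tgt = v ∧ deg f.hom = n}.Nonempty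

attribute [instance] KGraph.cat

variable {k : ℕ}

/-- A morphism of `k`-graphs: a degree-preserving functor. -/
@[ext]
structure KGraph.Hom (Λ Γ : KGraph.{u} k) where
  toFunctor : Λ.Vert ⥤ Γ.Vert
  deg_map : ∀ {v w : Λ.Vert} (f : v ⟶ w), Γ.deg (toFunctor.map f) = Λ.deg f

instance : LargeCategory (KGraph.{u} k) where
  Hom := KGraph.Hom
  id Λ := ⟨𝟭 _, fun _ => rfl⟩
  comp φ ψ := ⟨φ.toFunctor ⋙ ψ.toFunctor, fun f => (ψ.deg_map _).trans (φ.deg_map f)⟩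

/-- The degree of a path. -/
def KGraph.d (Λ : KGraph.{u} k) (f : Arr Λ.Vert) : Fin k → ℕ := Λ.deg f.hom

/-- The map induced by a morphism of `k`-graphs on vertices. -/
def vmap {Λ Γ : KGraph.{u} k} (φ : Λ ⟶ Γ) (v : Λ.Vert) : Γ.Vert := φ.toFunctor.obj v

/-- The map induced by a morphism of `k`-graphs on paths. -/
def amap {Λ Γ : KGraph.{u} k} (φ : Λ ⟶ Γ) (f : Arr Λ.Vert) : Arr Γ.Vert :=
  ⟨vmap φ f.src, vmap φ f.tgt, φ.toFunctor.map f.hom⟩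

/-! ### Coverings -/

/-- `(Ω, α)` is a covering of `Λ`: for every vertex `v` of `Ω`, `α` maps `Ωv` bijectively onto
`Λα(v)` and `vΩ` bijectively onto `α(v)Λ`. -/
def IsCovering {Ω Λ : KGraph.{u} k} (α : Ω ⟶ Λ) : Prop :=
  (∀ v : Ω.Vert, Set.BijOn (amap α) {f | f.src = v} {f | f.src = vmap α v}) ∧
  (∀ v : Ω.Vert, Set.BijOn (amap α) {f | f.tgt = v} {f | f.tgt = vmap α v})

/-- A covering of `Λ` is universal if it admits a morphism of coverings to every covering
of `Λ`. -/
def IsUniversalCovering {Ω Λ : KGraph.{u} k} (α : Ω ⟶ Λ) : Prop :=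
  IsCovering α ∧
    ∀ (S : KGraph.{u} k) (β : S ⟶ Λ), IsCovering β → ∃ φ : Ω ⟶ S, φ ≫ β = α

/-! ### Representation `k`-graphs -/

/-- `(Δ, α)` is a representation `k`-graph for `Λ`: for every vertex `v` of `Δ`, `α` maps `Δv`
bijectively onto `Λα(v)`, and `vΔⁿ` is a singleton for every `n ∈ ℕ^k`. -/
def IsRep {Δ Λ : KGraph.{u} k} (α : Δ ⟶ Λ) : Prop :=
  (∀ v : Δ.Vert, Set.BijOn (amap α) {f | f.src = v} {f | f.src = vmap α v}) ∧
  (∀ (v : Δ.Vert) (n : Fin k → ℕ), ∃! f : Arr Δ.Vert, f.tgt = v ∧ Δ.d f = n)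

/-- The objects of the category `RG(Λ)` of representation `k`-graphs for `Λ`. -/
structure RG (Λ : KGraph.{u} k) where
  graph : KGraph.{u} k
  map : graph ⟶ Λ
  isRep : IsRep map

/-- A morphism `(Δ, α) → (Σ, β)`: a morphism of `k`-graphs `φ : Δ → Σ` with `β ∘ φ = α`. -/
@[ext]
structure RG.Hom {Λ : KGraph.{u} k} (X Y : RG Λ) where
  toHom : X.graph ⟶ Y.graph
  comm : toHom ≫ Y.map = X.map

instance (Λ : KGraph.{u} k) : LargeCategory (RG Λ) where
  Hom := RG.Hom
  id X := ⟨𝟙 _, Category.id_comp _⟩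
  comp φ ψ := ⟨φ.toHom ≫ ψ.toHom, by rw [Category.assoc, ψ.comm, φ.comm]⟩

/-- An object `X` of a category is attracting if every object has a morphism to `X`. -/
def IsAttracting {C : Type*} [Category C] (X : C) : Prop := ∀ Y : C, Nonempty (Y ⟶ X)

/-! ### Walks -/

theorem KGraph.eq_id_of_deg (Λ : KGraph.{u} k) {v w : Λ.Vert} (f : v ⟶ w) (h : Λ.deg f = 0) :
    (⟨v, w, f⟩ : Arr Λ.Vert) = ⟨v, v, 𝟙 v⟩ := by
  have key := (Λ.factor f 0 0 (by simpa using h)).unique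
    (y₁ := ⟨w, f, 𝟙 w⟩) (y₂ := ⟨v, 𝟙 v, f⟩)
    ⟨Λ.deg_id w, h, Category.comp_id f⟩ ⟨h, Λ.deg_id v, Category.id_comp f⟩
  have h1 : w = v := congrArg Sigma.fst key
  subst h1
  simp only [Sigma.mk.injEq, heq_eq_eq, Prod.mk.injEq, true_and] at key
  rw [key.1]

theorem KGraph.isId_iff (Λ : KGraph.{u} k) (f : Arr Λ.Vert) : f.IsId ↔ Λ.d f = 0 := by
  constructor
  · rintro ⟨v, rfl⟩
    exact Λ.deg_id v
  · intro h
    exact ⟨f.src, Λ.eq_id_of_deg f.hom h⟩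

@[simp] theorem d_amap {Λ Γ : KGraph.{u} k} (φ : Λ ⟶ Γ) (f : Arr Λ.Vert) :
    Γ.d (amap φ f) = Λ.d f := φ.deg_map f.hom

theorem isId_amap {Λ Γ : KGraph.{u} k} (φ : Λ ⟶ Γ) (f : Arr Λ.Vert) :
    (amap φ f).IsId ↔ f.IsId := by
  rw [KGraph.isId_iff, KGraph.isId_iff, d_amap]

/-- The edges of the graph `E(Λ)_d`: the morphisms `λ` of `Λ`, and a reversed edge `λ*` for each
morphism `λ` which is not an identity. -/
inductive Edge (Λ : KGraph.{u} k) where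
  | fwd (f : Arr Λ.Vert)
  | bwd (f : Arr Λ.Vert) (hf : ¬ f.IsId)

/-- The vertex at which an edge starts. -/
def Edge.src {Λ : KGraph.{u} k} : Edge Λ → Λ.Vert
  | .fwd f => f.src
  | .bwd f _ => f.tgt

/-- The vertex at which an edge ends. -/
def Edge.tgt {Λ : KGraph.{u} k} : Edge Λ → Λ.Vert
  | .fwd f => f.tgt
  | .bwd f _ => f.src

/-- The map induced by a morphism of `k`-graphs on the edges of `E(Λ)_d`. -/
def Edge.map {Λ Γ : KGraph.{u} k} (φ : Λ ⟶ Γ) : Edge Λ → Edge Γ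
  | .fwd f => .fwd (amap φ f)
  | .bwd f hf => .bwd (amap φ f) (fun h => hf ((isId_amap φ f).1 h))

/-- `IsWalk v p w`: the sequence of edges `p = [e₁, …, eₙ]`, `n ≥ 1`, is a walk from `v` to `w`
(usually written `eₙ ⋯ e₁`), i.e. `e₁` starts at `v`, each edge starts where the preceding one
ends, and `eₙ` ends at `w`. -/
inductive IsWalk {Λ : KGraph.{u} k} : Λ.Vert → List (Edge Λ) → Λ.Vert → Prop
  | single (e : Edge Λ) : IsWalk e.src [e] e.tgt
  | cons (e : Edge Λ) {p : List (Edge Λ)} {w : Λ.Vert} :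
      IsWalk e.tgt p w → IsWalk e.src (e :: p) w

/-- The set `α(Walk_v(Δ))` of the images under `α` of the walks in `Δ` that start in `v`. -/
def walkImage {Δ Λ : KGraph.{u} k} (α : Δ ⟶ Λ) (v : Δ.Vert) : Set (List (Edge Λ)) :=
  {q | ∃ p w, IsWalk v p w ∧ p.map (Edge.map α) = q}

/-! ### Admissible equivalence relations -/

/-- The relation `∼` on the vertices of `Δ`: `v ∼ w` iff `α(Walk_v(Δ)) = α(Walk_w(Δ))`. -/
def RG.sim {Λ : KGraph.{u} k} (X : RG Λ) : Setoid X.graph.Vert where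
  r v w := walkImage X.map v = walkImage X.map w
  iseqv := ⟨fun _ => rfl, fun h => h.symm, fun h h' => h.trans h'⟩

/-- Admissible equivalence relations on the vertices of `Δ`. -/
structure RG.Admissible {Λ : KGraph.{u} k} (X : RG Λ) (R : Setoid X.graph.Vert) : Prop where
  le_sim : R ≤ X.sim
  walk : ∀ {v w x y : X.graph.Vert} {p q : List (Edge X.graph)}, R v w → IsWalk v p x →
    IsWalk w q y → p.map (Edge.map X.map) = q.map (Edge.map X.map) → R x y

section walks

variable {Λ : KGraph.{u} k} (X : RG Λ)

theorem RG.edge_det {e e' : Edge X.graph} (hs : e.src = e'.src)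
    (h : e.map X.map = e'.map X.map) : e = e' := by
  cases e with
  | fwd f =>
    cases e' with
    | fwd g =>
      simp only [Edge.map, Edge.fwd.injEq] at h
      rw [(X.isRep.1 g.src).injOn (show f.src = g.src from hs) rfl h]
    | bwd g hg => simp [Edge.map] at h
  | bwd f hf =>
    cases e' with
    | fwd g => simp [Edge.map] at h
    | bwd g hg =>
      simp only [Edge.map, Edge.bwd.injEq] at h
      have hd : X.graph.d f = X.graph.d g := by rw [← d_amap X.map, h, d_amap]
      have : f = g := (X.isRep.2 g.tgt (X.graph.d g)).unique ⟨hs, hd⟩ ⟨rfl, rfl⟩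
      subst this
      rfl

theorem IsWalk.append {Λ : KGraph.{u} k} {v w x : Λ.Vert} {p q : List (Edge Λ)}
    (hp : IsWalk v p w) (hq : IsWalk w q x) : IsWalk v (p ++ q) x := by
  induction hp with
  | single e => exact .cons e hq
  | cons e _ ih => exact .cons e (ih hq)

/-- A walk from `v` whose image starts with the image of a walk `q` from `v` starts with `q`. -/
theorem RG.walk_split {v x y : X.graph.Vert} {p q : List (Edge X.graph)} {r : List (Edge Λ)}
    (hq : IsWalk v q y) (hr : r ≠ []) (hp : IsWalk v p x)
    (h : p.map (Edge.map X.map) = q.map (Edge.map X.map) ++ r) :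
    ∃ p', IsWalk y p' x ∧ p'.map (Edge.map X.map) = r := by
  induction hq generalizing p with
  | single e =>
    generalize hv : e.src = v at hp
    cases hp with
    | single e' =>
      simp at h
      exact absurd h.2 hr
    | cons e' hp' =>
      simp only [List.map_cons, List.map_nil, List.cons_append, List.nil_append,
        List.cons.injEq] at h
      obtain rfl := X.edge_det hv h.1.symm
      exact ⟨_, hp', h.2⟩
  | cons e hq' ih =>
    generalize hv : e.src = v at hp
    cases hp with
    | single e' => simp [hr] at h
    | cons e' hp' =>
      simp only [List.map_cons, List.cons_append, List.cons.injEq] at h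
      obtain rfl := X.edge_det hv h.1.symm
      exact ih hp' h.2

theorem IsWalk.ne_nil {Λ : KGraph.{u} k} {v w : Λ.Vert} {p : List (Edge Λ)}
    (hp : IsWalk v p w) : p ≠ [] := by
  cases hp <;> simp

theorem RG.sim_walk_aux {v w x y : X.graph.Vert} {p q : List (Edge X.graph)}
    (hvw : walkImage X.map v = walkImage X.map w) (hp : IsWalk v p x) (hq : IsWalk w q y)
    (h : p.map (Edge.map X.map) = q.map (Edge.map X.map)) :
    walkImage X.map x ⊆ walkImage X.map y := by
  rintro _ ⟨t, z, ht, rfl⟩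
  have hm : (p ++ t).map (Edge.map X.map) ∈ walkImage X.map w := by
    rw [← hvw]; exact ⟨_, z, hp.append ht, rfl⟩
  obtain ⟨s, z', hs, hs'⟩ := hm
  rw [List.map_append, h] at hs'
  obtain ⟨p', hp', e⟩ := X.walk_split hq (by simpa using ht.ne_nil) hs hs'
  exact ⟨p', z', hp', e⟩

/-- The relation `∼` is admissible. -/
theorem RG.sim_admissible : X.Admissible X.sim where
  le_sim := le_refl _
  walk hvw hp hq h := Set.Subset.antisymm (X.sim_walk_aux hvw hp hq h)
    (X.sim_walk_aux hvw.symm hq hp h.symm)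

end walks

/-! ### Quotients -/

/-- The composite `g ∘ f` of paths `f`, `g` with `r(f) = s(g)`. -/
def Arr.comp {V : Type u} [SmallCategory V] (f g : Arr V) (h : f.tgt = g.src) : Arr V :=
  ⟨f.src, g.tgt, f.hom ≫ eqToHom h ≫ g.hom⟩

theorem Arr.comp_mk {V : Type u} [SmallCategory V] {a b c : V} (f : a ⟶ b) (g : b ⟶ c) :
    Arr.comp ⟨a, b, f⟩ ⟨b, c, g⟩ rfl = ⟨a, c, f ≫ g⟩ := by simp [Arr.comp]

theorem Arr.comp_assoc {V : Type u} [SmallCategory V] (f g h : Arr V) (hfg : f.tgt = g.src)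
    (hgh : g.tgt = h.src) :
    (f.comp g hfg).comp h hgh = f.comp (g.comp h hgh) hfg := by
  simp [Arr.comp]

theorem amap_comp {Λ Γ : KGraph.{u} k} (φ : Λ ⟶ Γ) (f g : Arr Λ.Vert) (h : f.tgt = g.src) :
    amap φ (f.comp g h) = (amap φ f).comp (amap φ g) (congrArg (vmap φ) h) := by
  obtain ⟨a, b, f⟩ := f
  obtain ⟨c, d, g⟩ := g
  obtain rfl : b = c := h
  rw [Arr.comp_mk]
  refine Eq.trans ?_ (Arr.comp_mk (φ.toFunctor.map f) (φ.toFunctor.map g)).symm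
  exact congrArg (Arr.mk _ _) (φ.toFunctor.map_comp f g)

theorem amap_id {Λ Γ : KGraph.{u} k} (φ : Λ ⟶ Γ) (v : Λ.Vert) :
    amap φ ⟨v, v, 𝟙 v⟩ = ⟨vmap φ v, vmap φ v, 𝟙 (vmap φ v)⟩ :=
  congrArg (Arr.mk _ _) (φ.toFunctor.map_id v)

theorem d_comp {Λ : KGraph.{u} k} (f g : Arr Λ.Vert) (h : f.tgt = g.src) :
    Λ.d (f.comp g h) = Λ.d f + Λ.d g := by
  obtain ⟨a, b, f⟩ := f
  obtain ⟨c, d, g⟩ := g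
  obtain rfl : b = c := h
  simp [Arr.comp, KGraph.d, Λ.deg_comp]

/-- The factorisation property for paths. -/
theorem factor_unique {Λ : KGraph.{u} k} {f g f' g' : Arr Λ.Vert} {h : f.tgt = g.src}
    {h' : f'.tgt = g'.src} (e : f.comp g h = f'.comp g' h') (hf : Λ.d f = Λ.d f')
    (hg : Λ.d g = Λ.d g') : f = f' ∧ g = g' := by
  obtain ⟨a, b, f⟩ := f
  obtain ⟨c, d, g⟩ := g
  obtain ⟨a', b', f'⟩ := f'
  obtain ⟨c', d', g'⟩ := g'
  obtain rfl : b = c := h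
  obtain rfl : b' = c' := h'
  rw [Arr.comp_mk, Arr.comp_mk] at e
  obtain rfl : a = a' := congrArg Arr.src e
  obtain rfl : d = d' := congrArg Arr.tgt e
  simp only [Arr.mk.injEq, heq_eq_eq, true_and] at e
  have key := (Λ.factor (f ≫ g) (Λ.deg g) (Λ.deg f) (by rw [Λ.deg_comp, add_comm])).unique
    (y₁ := ⟨b, f, g⟩) (y₂ := ⟨b', f', g'⟩) ⟨rfl, rfl, rfl⟩ ⟨hg.symm, hf.symm, e.symm⟩
  obtain rfl : b = b' := congrArg Sigma.fst key
  simp only [Sigma.mk.injEq, heq_eq_eq, Prod.mk.injEq, true_and] at key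
  rw [key.1, key.2]
  exact ⟨rfl, rfl⟩

namespace RG.Admissible

variable {Λ : KGraph.{u} k} {X : RG Λ} {R : Setoid X.graph.Vert}

theorem vmap_eq (hR : X.Admissible R) {v w : X.graph.Vert} (h : R v w) :
    vmap X.map v = vmap X.map w := by
  have hs : walkImage X.map v = walkImage X.map w := hR.le_sim h
  have hm : [Edge.map X.map (.fwd ⟨v, v, 𝟙 v⟩)] ∈ walkImage X.map w := by
    rw [← hs]
    exact ⟨_, v, IsWalk.single (.fwd ⟨v, v, 𝟙 v⟩), rfl⟩
  obtain ⟨p, x, hp, hpe⟩ := hm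
  cases hp with
  | single e =>
    cases e with
    | fwd f =>
      simp only [List.map_cons, List.map_nil, Edge.map, List.cons.injEq, Edge.fwd.injEq,
        and_true] at hpe
      exact (congrArg Arr.src hpe).symm
    | bwd f hf => simp [Edge.map] at hpe
  | cons e hp' =>
    have := hp'.ne_nil
    simp_all

theorem lift_src (hR : X.Admissible R) {v : X.graph.Vert} (f : Arr X.graph.Vert)
    (h : R v f.src) : ∃ g : Arr X.graph.Vert, g.src = v ∧ amap X.map g = amap X.map f := by
  obtain ⟨g, hg, hg'⟩ := (X.isRep.1 v).surjOn
    (show (amap X.map f).src = vmap X.map v from (hR.vmap_eq h).symm)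
  exact ⟨g, hg, hg'⟩

theorem tgt_rel (hR : X.Admissible R) {f g : Arr X.graph.Vert} (h : R f.src g.src)
    (e : amap X.map f = amap X.map g) : R f.tgt g.tgt :=
  hR.walk h (IsWalk.single (.fwd f)) (IsWalk.single (.fwd g)) (by simp [Edge.map, e])

theorem src_rel (hR : X.Admissible R) {f g : Arr X.graph.Vert} (h : R f.tgt g.tgt)
    (hd : X.graph.d f = X.graph.d g) : R f.src g.src ∧ amap X.map f = amap X.map g := by
  by_cases hf : f.IsId
  · have hg : g.IsId := by rwa [KGraph.isId_iff, ← hd, ← KGraph.isId_iff]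
    obtain ⟨v, rfl⟩ := hf
    obtain ⟨w, rfl⟩ := hg
    refine ⟨h, ?_⟩
    have e : vmap X.map v = vmap X.map w := hR.vmap_eq h
    rw [amap_id, amap_id, e]
  · have hg : ¬ g.IsId := by rwa [KGraph.isId_iff, ← hd, ← KGraph.isId_iff]
    have hs : walkImage X.map f.tgt = walkImage X.map g.tgt := hR.le_sim h
    have e : amap X.map f = amap X.map g := by
      have hm : [Edge.map X.map (.bwd f hf)] ∈ walkImage X.map g.tgt := by
        rw [← hs]
        exact ⟨_, _, IsWalk.single (.bwd f hf), rfl⟩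
      obtain ⟨p, x, hp, hpe⟩ := hm
      generalize hv : g.tgt = v at hp
      cases hp with
      | single e =>
        cases e with
        | fwd f => simp [Edge.map] at hpe
        | bwd f' hf' =>
          simp only [List.map_cons, List.map_nil, Edge.map, List.cons.injEq, Edge.bwd.injEq,
            and_true] at hpe
          have hd' : X.graph.d f' = X.graph.d g := by rw [← d_amap X.map, hpe, d_amap, hd]
          have : f' = g := (X.isRep.2 g.tgt (X.graph.d g)).unique ⟨hv.symm, hd'⟩ ⟨rfl, rfl⟩
          rw [← hpe, this]
      | cons e hp' =>
        have := hp'.ne_nil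
        simp_all
    exact ⟨hR.walk h (IsWalk.single (.bwd f hf)) (IsWalk.single (.bwd g hg))
      (by simp [Edge.map, e]), e⟩

/-- The equivalence relation `≈` on the paths of `Δ` induced by an admissible equivalence
relation on the vertices: `δ ≈ δ'` iff `s(δ) ≈ s(δ')` and `α(δ) = α(δ')`. -/
def arrSetoid (_ : X.Admissible R) : Setoid (Arr X.graph.Vert) where
  r f g := R f.src g.src ∧ amap X.map f = amap X.map g
  iseqv := ⟨fun f => ⟨R.refl f.src, rfl⟩, fun h => ⟨R.symm h.1, h.2.symm⟩,
    fun h h' => ⟨R.trans h.1 h'.1, h.2.trans h'.2⟩⟩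

/-- The vertices of the quotient `Δ_≈`. -/
def QVert (_ : X.Admissible R) : Type u := Quotient R

/-- The class of a vertex. -/
def qv (hR : X.Admissible R) (v : X.graph.Vert) : hR.QVert := Quotient.mk R v

theorem qv_eq (hR : X.Admissible R) {v w : X.graph.Vert} : hR.qv v = hR.qv w ↔ R v w :=
  Quotient.eq

/-- The paths of the quotient `Δ_≈`. -/
def QArr (hR : X.Admissible R) : Type u := Quotient hR.arrSetoid

/-- The class of a path. -/
def qa (hR : X.Admissible R) (f : Arr X.graph.Vert) : hR.QArr := Quotient.mk hR.arrSetoid f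

theorem qa_eq (hR : X.Admissible R) {f g : Arr X.graph.Vert} :
    hR.qa f = hR.qa g ↔ R f.src g.src ∧ amap X.map f = amap X.map g :=
  Quotient.eq (r := hR.arrSetoid)

/-- The source `s([δ]) = [s(δ)]`. -/
def qsrc (hR : X.Admissible R) : hR.QArr → hR.QVert :=
  Quotient.lift (fun f => hR.qv f.src) fun _ _ h => hR.qv_eq.2 h.1

/-- The range `r([δ]) = [r(δ)]`. -/
def qtgt (hR : X.Admissible R) : hR.QArr → hR.QVert :=
  Quotient.lift (fun f => hR.qv f.tgt) fun _ _ h => hR.qv_eq.2 (hR.tgt_rel h.1 h.2)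

/-- The degree `d([δ]) = d(δ)`. -/
def qdeg (hR : X.Admissible R) : hR.QArr → (Fin k → ℕ) :=
  Quotient.lift (fun f => X.graph.d f) fun f g h => by rw [← d_amap X.map, h.2, d_amap]

/-- The image `α_≈([δ]) = α(δ)`. -/
def qamap (hR : X.Admissible R) : hR.QArr → Arr Λ.Vert :=
  Quotient.lift (fun f => amap X.map f) fun _ _ h => h.2

/-- The image `α_≈([v]) = α(v)`. -/
def qvmap (hR : X.Admissible R) : hR.QVert → Λ.Vert :=
  Quotient.lift (fun v => vmap X.map v) fun _ _ h => hR.vmap_eq h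

theorem exists_qv (hR : X.Admissible R) (a : hR.QVert) : ∃ v, hR.qv v = a :=
  Quotient.exists_rep a

theorem exists_qa (hR : X.Admissible R) (x : hR.QArr) : ∃ f, hR.qa f = x :=
  Quotient.exists_rep x

/-- A path of the quotient has a representative starting in any prescribed representative of
its source. -/
theorem exists_qa_src (hR : X.Admissible R) (v : X.graph.Vert) (x : hR.QArr)
    (h : hR.qv v = hR.qsrc x) : ∃ g : Arr X.graph.Vert, v = g.src ∧ hR.qa g = x := by
  obtain ⟨f, rfl⟩ := hR.exists_qa x
  have h' : R v f.src := hR.qv_eq.1 h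
  obtain ⟨g, hg, hg'⟩ := hR.lift_src f h'
  exact ⟨g, hg.symm, hR.qa_eq.2 ⟨by rwa [hg], hg'⟩⟩

theorem qcomp_exists (hR : X.Admissible R) (x y : hR.QArr) (h : hR.qtgt x = hR.qsrc y) :
    ∃ z : hR.QArr, ∃ (f g : Arr X.graph.Vert) (hfg : f.tgt = g.src),
      hR.qa f = x ∧ hR.qa g = y ∧ hR.qa (f.comp g hfg) = z := by
  obtain ⟨f, rfl⟩ := hR.exists_qa x
  obtain ⟨g, hg, hg'⟩ := hR.exists_qa_src f.tgt y h
  exact ⟨_, f, g, hg, rfl, hg', rfl⟩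

/-- The composite `y ∘ x = [δ'' ∘ δ']` in the quotient, where `δ'`, `δ''` are composable
representatives of `x` and `y`. By `qcomp_qa` it does not depend on their choice. -/
noncomputable def qcomp (hR : X.Admissible R) (x y : hR.QArr) (h : hR.qtgt x = hR.qsrc y) :
    hR.QArr :=
  (hR.qcomp_exists x y h).choose

theorem qcomp_qa (hR : X.Admissible R) (f g : Arr X.graph.Vert) (hfg : f.tgt = g.src)
    (h : hR.qtgt (hR.qa f) = hR.qsrc (hR.qa g)) :
    hR.qcomp (hR.qa f) (hR.qa g) h = hR.qa (f.comp g hfg) := by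
  obtain ⟨f', g', hfg', hf, hg, e⟩ := (hR.qcomp_exists (hR.qa f) (hR.qa g) h).choose_spec
  refine e.symm.trans (hR.qa_eq.2 ?_)
  have hf := hR.qa_eq.1 hf
  have hg := hR.qa_eq.1 hg
  refine ⟨hf.1, ?_⟩
  rw [amap_comp, amap_comp]
  simp only [hf.2, hg.2]

/-- The category `Δ_≈`. -/
noncomputable instance qcat (hR : X.Admissible R) : SmallCategory hR.QVert where
  Hom a b := {x : hR.QArr // hR.qsrc x = a ∧ hR.qtgt x = b}
  id a := ⟨a.lift (fun v => hR.qa ⟨v, v, 𝟙 v⟩) (fun v w h => hR.qa_eq.2 ⟨h, by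
      rw [amap_id, amap_id, show vmap X.map v = vmap X.map w from hR.vmap_eq h]⟩), by
    obtain ⟨v, rfl⟩ := hR.exists_qv a
    exact ⟨rfl, rfl⟩⟩
  comp {a b c} x y := ⟨hR.qcomp x.1 y.1 (x.2.2.trans y.2.1.symm), by
    obtain ⟨x, rfl, hx⟩ := x
    obtain ⟨y, hy, rfl⟩ := y
    obtain ⟨f, rfl⟩ := hR.exists_qa x
    obtain ⟨g, hg, rfl⟩ := hR.exists_qa_src f.tgt y (hx.trans hy.symm)
    rw [hR.qcomp_qa f g hg]
    exact ⟨rfl, rfl⟩⟩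
  id_comp {a b} x := by
    obtain ⟨x, rfl, rfl⟩ := x
    obtain ⟨f, rfl⟩ := hR.exists_qa x
    refine Subtype.ext ((hR.qcomp_qa ⟨f.src, f.src, 𝟙 f.src⟩ f rfl rfl).trans ?_)
    simp [Arr.comp]
  comp_id {a b} x := by
    obtain ⟨x, rfl, rfl⟩ := x
    obtain ⟨f, rfl⟩ := hR.exists_qa x
    refine Subtype.ext ((hR.qcomp_qa f ⟨f.tgt, f.tgt, 𝟙 f.tgt⟩ rfl rfl).trans ?_)
    simp [Arr.comp]
  assoc {a b c e} x y z := by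
    obtain ⟨x, rfl, hx⟩ := x
    obtain ⟨y, hy, hy'⟩ := y
    obtain ⟨z, hz, rfl⟩ := z
    obtain ⟨f, rfl⟩ := hR.exists_qa x
    obtain ⟨g, hg, rfl⟩ := hR.exists_qa_src f.tgt y (hx.trans hy.symm)
    obtain ⟨h, hh, rfl⟩ := hR.exists_qa_src g.tgt z (hy'.trans hz.symm)
    refine Subtype.ext ?_
    simp only [hR.qcomp_qa f g hg, hR.qcomp_qa g h hh]
    rw [hR.qcomp_qa (f.comp g hg) h hh, hR.qcomp_qa f (g.comp h hh) hg, Arr.comp_assoc]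

/-- The class of a path, as a morphism of the category `Δ_≈`. -/
def qhom (hR : X.Admissible R) (f : Arr X.graph.Vert) : hR.qv f.src ⟶ hR.qv f.tgt :=
  ⟨hR.qa f, rfl, rfl⟩

/-- A morphism of the category `Δ_≈`, as a path of the quotient. -/
def qval (hR : X.Admissible R) {a b : hR.QVert} (x : a ⟶ b) : hR.QArr := x.1

theorem qsrc_qval (hR : X.Admissible R) {a b : hR.QVert} (x : a ⟶ b) :
    hR.qsrc (hR.qval x) = a := x.2.1

theorem qtgt_qval (hR : X.Admissible R) {a b : hR.QVert} (x : a ⟶ b) :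
    hR.qtgt (hR.qval x) = b := x.2.2

/-- Any pair of composable morphisms of `Δ_≈` is represented by a composable pair of paths. -/
theorem exists_rep₂ (hR : X.Admissible R) {a b c : hR.QVert} (x : a ⟶ b) (y : b ⟶ c) :
    ∃ (f g : Arr X.graph.Vert) (hfg : f.tgt = g.src), hR.qval x = hR.qa f ∧ hR.qval y = hR.qa g ∧
      hR.qval (x ≫ y) = hR.qa (f.comp g hfg) := by
  obtain ⟨x, rfl, hx⟩ := x
  obtain ⟨y, hy, rfl⟩ := y
  obtain ⟨f, rfl⟩ := hR.exists_qa x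
  obtain ⟨g, hg, rfl⟩ := hR.exists_qa_src f.tgt y (hx.trans hy.symm)
  exact ⟨f, g, hg, rfl, rfl, hR.qcomp_qa f g hg (hx.trans hy.symm)⟩

theorem sigma_ext (hR : X.Admissible R) {a c : hR.QVert}
    {p q : Σ b : hR.QVert, (a ⟶ b) × (b ⟶ c)} (h₁ : hR.qval p.2.1 = hR.qval q.2.1)
    (h₂ : hR.qval p.2.2 = hR.qval q.2.2) : p = q := by
  obtain ⟨b, ⟨x, hx, rfl⟩, ⟨y, hy⟩⟩ := p
  obtain ⟨b', ⟨x', hx', rfl⟩, ⟨y', hy'⟩⟩ := q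
  obtain rfl : x = x' := h₁
  obtain rfl : y = y' := h₂
  rfl

theorem arr_ext (hR : X.Admissible R) {p q : Arr hR.QVert} (h : hR.qval p.hom = hR.qval q.hom) : p = q := by
  obtain ⟨a, b, ⟨x, rfl, rfl⟩⟩ := p
  obtain ⟨a', b', ⟨x', rfl, rfl⟩⟩ := q
  obtain rfl : x = x' := h
  rfl

theorem existsUnique_in (hR : X.Admissible R) (a : hR.QVert) (n : Fin k → ℕ) :
    ∃! f : Arr hR.QVert, f.tgt = a ∧ hR.qdeg (hR.qval f.hom) = n := by
  obtain ⟨v, rfl⟩ := hR.exists_qv a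
  obtain ⟨f, ⟨rfl, rfl⟩, -⟩ := X.isRep.2 v n
  refine ⟨⟨_, _, hR.qhom f⟩, ⟨rfl, rfl⟩, ?_⟩
  rintro ⟨b, c, ⟨x, rfl, rfl⟩⟩ ⟨h₁, h₂⟩
  obtain ⟨g, rfl⟩ := hR.exists_qa x
  exact hR.arr_ext (hR.qa_eq.2 (hR.src_rel (hR.qv_eq.1 h₁) h₂))

theorem zigzag_qv (hR : X.Admissible R) {v w : X.graph.Vert} (h : Zigzag v w) :
    Zigzag (hR.qv v) (hR.qv w) := by
  induction h with
  | refl => exact Zigzag.refl _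
  | tail _ h ih =>
    refine ih.trans ?_
    obtain ⟨⟨f⟩⟩ | ⟨⟨f⟩⟩ := h
    · exact Zigzag.of_hom (hR.qhom ⟨_, _, f⟩)
    · exact Zigzag.of_inv (hR.qhom ⟨_, _, f⟩)

/-- The `k`-graph `Δ_≈`. -/
noncomputable def qgraph (hR : X.Admissible R) : KGraph.{u} k where
  Vert := hR.QVert
  deg x := hR.qdeg (hR.qval x)
  deg_id a := by
    obtain ⟨v, rfl⟩ := hR.exists_qv a
    exact X.graph.deg_id v
  deg_comp x y := by
    obtain ⟨f, g, hfg, hx, hy, hxy⟩ := hR.exists_rep₂ x y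
    rw [hx, hy, hxy]
    exact d_comp f g hfg
  factor {a c} x m n h := by
    obtain ⟨x, rfl, rfl⟩ := x
    obtain ⟨⟨v, w, f⟩, rfl⟩ := hR.exists_qa x
    obtain ⟨⟨z, p, q⟩, ⟨hq, hp, hpq⟩, -⟩ := X.graph.factor f m n h
    have e : hR.qhom ⟨v, z, p⟩ ≫ hR.qhom ⟨z, w, q⟩ = hR.qhom ⟨v, w, f⟩ := by
      refine Subtype.ext ((hR.qcomp_qa ⟨v, z, p⟩ ⟨z, w, q⟩ rfl rfl).trans ?_)
      rw [Arr.comp_mk, hpq]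
      rfl
    refine ⟨⟨hR.qv z, hR.qhom ⟨v, z, p⟩, hR.qhom ⟨z, w, q⟩⟩, ⟨hq, hp, e⟩, ?_⟩
    rintro ⟨b, x, y⟩ ⟨hy, hx, hxy⟩
    obtain ⟨f', g', hfg', hx', hy', hxy'⟩ := hR.exists_rep₂ x y
    have e' : hR.qa (f'.comp g' hfg') = hR.qa ⟨v, w, f⟩ := by
      rw [← hxy']
      exact congrArg hR.qval hxy
    obtain ⟨hs, ha⟩ := hR.qa_eq.1 e'
    rw [← hpq, ← Arr.comp_mk, amap_comp, amap_comp] at ha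
    replace hx : hR.qdeg (hR.qval x) = n := hx
    replace hy : hR.qdeg (hR.qval y) = m := hy
    rw [hx'] at hx
    rw [hy'] at hy
    obtain ⟨h₁, h₂⟩ := factor_unique ha
      (by rw [d_amap, d_amap]; exact (hx : X.graph.d f' = n).trans hp.symm)
      (by rw [d_amap, d_amap]; exact (hy : X.graph.d g' = m).trans hq.symm)
    refine hR.sigma_ext (hx'.trans (hR.qa_eq.2 ⟨hs, h₁⟩)) (hy'.trans (hR.qa_eq.2 ⟨?_, h₂⟩))
    rw [← hfg']
    exact hR.tgt_rel (f := f') (g := ⟨v, z, p⟩) hs h₁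
  nonempty := X.graph.nonempty.map hR.qv
  connected a b := by
    obtain ⟨v, rfl⟩ := hR.exists_qv a
    obtain ⟨w, rfl⟩ := hR.exists_qv b
    exact hR.zigzag_qv (X.graph.connected v w)
  rowFinite a n := Set.Subsingleton.finite fun _ hf _ hg =>
    (hR.existsUnique_in a n).unique hf hg
  noSources a n := (hR.existsUnique_in a n).exists

theorem eqToHom_arr {V : Type u} [SmallCategory V] {a b : V} (f : Arr V) (h₁ : f.src = a)
    (h₂ : f.tgt = b) :
    (⟨a, b, eqToHom h₁.symm ≫ f.hom ≫ eqToHom h₂⟩ : Arr V) = f := by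
  subst h₁ h₂
  simp

theorem qamap_src (hR : X.Admissible R) (x : hR.QArr) :
    (hR.qamap x).src = hR.qvmap (hR.qsrc x) := by
  obtain ⟨f, rfl⟩ := hR.exists_qa x
  rfl

theorem qamap_tgt (hR : X.Admissible R) (x : hR.QArr) :
    (hR.qamap x).tgt = hR.qvmap (hR.qtgt x) := by
  obtain ⟨f, rfl⟩ := hR.exists_qa x
  rfl

theorem hom_of_arr_eq {V : Type u} [SmallCategory V] {a b : V} {f g : a ⟶ b}
    (h : (⟨a, b, f⟩ : Arr V) = ⟨a, b, g⟩) : f = g := by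
  simpa using h

/-- The image of a morphism of `Δ_≈` under `α_≈`, as a morphism of `Λ`. -/
def qhmap (hR : X.Admissible R) {a b : hR.QVert} (x : a ⟶ b) : hR.qvmap a ⟶ hR.qvmap b :=
  eqToHom ((congrArg hR.qvmap (hR.qsrc_qval x)).symm.trans (hR.qamap_src _).symm) ≫
    (hR.qamap (hR.qval x)).hom ≫
      eqToHom ((hR.qamap_tgt _).trans (congrArg hR.qvmap (hR.qtgt_qval x)))

theorem arr_qhmap (hR : X.Admissible R) {a b : hR.QVert} (x : a ⟶ b) :
    (⟨hR.qvmap a, hR.qvmap b, hR.qhmap x⟩ : Arr Λ.Vert) = hR.qamap (hR.qval x) :=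
  eqToHom_arr _ ((hR.qamap_src _).trans (congrArg hR.qvmap (hR.qsrc_qval x)))
    ((hR.qamap_tgt _).trans (congrArg hR.qvmap (hR.qtgt_qval x)))

/-- The functor underlying the morphism `α_≈ : Δ_≈ → Λ`, `α_≈([v]) = α(v)`,
`α_≈([δ]) = α(δ)`. -/
noncomputable def qfunctor (hR : X.Admissible R) : hR.QVert ⥤ Λ.Vert where
  obj := hR.qvmap
  map x := hR.qhmap x
  map_id a := by
    obtain ⟨v, rfl⟩ := hR.exists_qv a
    apply hom_of_arr_eq
    rw [arr_qhmap]
    exact amap_id X.map v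
  map_comp {a b c} x y := by
    obtain ⟨f, g, hfg, hx, hy, hxy⟩ := hR.exists_rep₂ x y
    apply hom_of_arr_eq
    rw [← Arr.comp_mk]
    simp only [arr_qhmap, hx, hy, hxy]
    exact amap_comp X.map f g hfg

/-- The morphism of `k`-graphs `α_≈ : Δ_≈ → Λ`. -/
noncomputable def qmap (hR : X.Admissible R) : hR.qgraph ⟶ Λ where
  toFunctor := hR.qfunctor
  deg_map {a b} x := by
    obtain ⟨f, hf⟩ := hR.exists_qa (hR.qval x)
    refine (congrArg Λ.d (hR.arr_qhmap x)).trans ?_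
    rw [← hf]
    refine (d_amap X.map f).trans ?_
    exact congrArg hR.qdeg hf

theorem amap_qmap (hR : X.Admissible R) (x : Arr hR.QVert) :
    @amap k hR.qgraph Λ hR.qmap x = hR.qamap (hR.qval x.hom) :=
  hR.arr_qhmap x.hom

theorem isRep_qmap (hR : X.Admissible R) : IsRep hR.qmap := by
  refine ⟨fun a => ⟨?_, ?_, ?_⟩, fun a n => hR.existsUnique_in a n⟩
  · rintro x (rfl : x.src = a)
    rfl
  · intro p hp q hq e
    replace e := ((hR.amap_qmap p).symm.trans e).trans (hR.amap_qmap q)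
    obtain ⟨f, hf⟩ := hR.exists_qa (hR.qval p.hom)
    obtain ⟨g, hg⟩ := hR.exists_qa (hR.qval q.hom)
    have hs : hR.qsrc (hR.qval p.hom) = hR.qsrc (hR.qval q.hom) :=
      (hR.qsrc_qval p.hom).trans (Eq.trans (Eq.trans hp (Eq.symm hq)) (hR.qsrc_qval q.hom).symm)
    apply hR.arr_ext
    rw [← hf, ← hg] at e hs ⊢
    exact hR.qa_eq.2 ⟨hR.qv_eq.1 hs, e⟩
  · intro y hy
    obtain ⟨v, rfl⟩ := hR.exists_qv a
    obtain ⟨f, rfl, rfl⟩ := (X.isRep.1 v).surjOn (show y.src = vmap X.map v from hy)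
    exact ⟨⟨_, _, hR.qhom f⟩, rfl, hR.amap_qmap _⟩

end RG.Admissible

/-- The quotient `(Δ_≈, α_≈)` of a representation `k`-graph `(Δ, α)` by an admissible equivalence
relation `≈`. -/
noncomputable def RG.quot {Λ : KGraph.{u} k} (X : RG Λ) (R : Setoid X.graph.Vert)
    (hR : X.Admissible R) : RG Λ :=
  ⟨hR.qgraph, hR.qmap, hR.isRep_qmap⟩

/-- The quotient `(Δ_∼, α_∼)` by the coarsest admissible equivalence relation `∼`. -/
noncomputable def RG.simQuot {Λ : KGraph.{u} k} (X : RG Λ) : RG Λ := X.quot X.sim X.sim_admissible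

/-! ### Composing with a covering -/

theorem IsRep.comp_covering {Ω Δ Λ : KGraph.{u} k} {τ : Ω ⟶ Δ} {α : Δ ⟶ Λ} (hα : IsRep α)
    (hτ : IsCovering τ) : IsRep (τ ≫ α) := by
  refine ⟨fun v => (hα.1 (vmap τ v)).comp (hτ.1 v), fun v n => ?_⟩
  obtain ⟨f, ⟨hf, rfl⟩, hu⟩ := hα.2 (vmap τ v) n
  obtain ⟨g, hg, rfl⟩ := (hτ.2 v).surjOn hf
  refine ⟨g, ⟨hg, (d_amap τ g).symm⟩, ?_⟩
  rintro g' ⟨hg', hd⟩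
  refine (hτ.2 v).injOn hg' hg (hu _ ⟨congrArg (vmap τ) hg', ?_⟩)
  rw [d_amap, hd]

/-- The representation `k`-graph `(Ω, α ∘ τ)`, for a representation `k`-graph `(Δ, α)` and a
covering `(Ω, τ)` of `Δ`. -/
def RG.pullback {Λ : KGraph.{u} k} (X : RG Λ) {Ω : KGraph.{u} k} (τ : Ω ⟶ X.graph)
    (hτ : IsCovering τ) : RG Λ :=
  ⟨Ω, τ ≫ X.map, X.isRep.comp_covering hτ⟩

end HRG

/-! Two facts drive the proof. Every morphism of representation `k`-graphs is a covering
(`RG.Hom.isCovering`), because a path into a vertex is determined by its degree. And coverings lift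
walks, so they do not change the set of walk labels read off at a vertex
(`IsCovering.walkImage_comp`).

By the second fact, a morphism `X ⟶ Z` identifies only `∼`-equivalent vertices of `X`; hence `Z`
maps to `X_∼` (`RG.nonempty_hom_simQuot_of_hom`). It remains to map a universal covering `Ω` of one
object to every object of its component (`RG.nonempty_hom_of_zigzag`). Arrows of a zigzag pointing
forward are composed; at `Ω → Y ← Z` a universal covering of `Y` maps to both `Ω` and `Z`, and
universality of `Ω` supplies a morphism back from `Ω` to it.

This needs universal coverings to exist: they are built as the category of elements of `v ↦ Hom(v₀,
v)` in the free groupoid, and the Yoneda lemma gives universality. The description of the objects of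
the component then follows from the first fact and from `IsRep.comp_covering`. -/

namespace HRG

variable {k : ℕ}

/-! ### Constructing morphisms of `k`-graphs -/

theorem hom_ext_amap {T S : KGraph.{u} k} {φ ψ : T ⟶ S} (h : ∀ f, amap φ f = amap ψ f) :
    φ = ψ := by
  refine KGraph.Hom.ext (CategoryTheory.Functor.hext (fun v => ?_) fun v w f => ?_)
  · exact congrArg Arr.src (h ⟨v, v, 𝟙 v⟩)
  · have := h ⟨v, w, f⟩
    simp only [amap] at this
    exact (Arr.mk.inj this).2.2

theorem Arr.comp_congr {V : Type u} [SmallCategory V] {f f' g g' : Arr V} (hf : f = f')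
    (hg : g = g') (h : f.tgt = g.src) (h' : f'.tgt = g'.src) : f.comp g h = f'.comp g' h' := by
  subst hf hg
  rfl

theorem amap_comp_apply {T S Λ : KGraph.{u} k} (φ : T ⟶ S) (β : S ⟶ Λ) (f : Arr T.Vert) :
    amap (φ ≫ β) f = amap β (amap φ f) := rfl

theorem vmap_comp_apply {T S Λ : KGraph.{u} k} (φ : T ⟶ S) (β : S ⟶ Λ) (v : T.Vert) :
    vmap (φ ≫ β) v = vmap β (vmap φ v) := rfl

/-- A map on vertices along which all paths lift extends to a morphism of `k`-graphs. -/
theorem exists_hom_of_vertexMap {T S Λ : KGraph.{u} k} (α : T ⟶ Λ) (β : S ⟶ Λ)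
    (hβ : ∀ v, Set.InjOn (amap β) {f | f.src = v}) (g : T.Vert → S.Vert)
    (hg : ∀ f : Arr T.Vert, ∃ f' : Arr S.Vert,
      f'.src = g f.src ∧ f'.tgt = g f.tgt ∧ amap β f' = amap α f) :
    ∃ φ : T ⟶ S, φ ≫ β = α ∧ ∀ v, vmap φ v = g v := by
  choose l hs ht he using hg
  let m : ∀ {v w : T.Vert} (f : v ⟶ w), g v ⟶ g w := fun {v w} f =>
    -- The endpoints of the chosen lift agree with the values of `g` only up to a proved equality,
    -- hence the transports.
    eqToHom (hs ⟨v, w, f⟩).symm ≫ (l ⟨v, w, f⟩).hom ≫ eqToHom (ht ⟨v, w, f⟩)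
  have hm : ∀ {v w : T.Vert} (f : v ⟶ w), (⟨g v, g w, m f⟩ : Arr S.Vert) = l ⟨v, w, f⟩ :=
    fun {v w} f => RG.Admissible.eqToHom_arr (l ⟨v, w, f⟩) (hs _) (ht _)
  have hd : ∀ f : Arr T.Vert, S.d (l f) = T.d f := fun f => by
    rw [← d_amap β, he, d_amap]
  let F : T.Vert ⥤ S.Vert :=
    { obj := g
      map := fun f => m f
      map_id := fun v => by
        apply RG.Admissible.hom_of_arr_eq
        rw [hm]
        -- Functoriality comes from uniqueness of lifts: both sides start at the same vertex and
        -- have the same image under `β`. The same argument handles composites.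
        refine hβ (g v) (hs _) rfl ?_
        rw [he, amap_id, amap_id]
        have : vmap β (g v) = vmap α v := by
          have := congrArg Arr.src (he ⟨v, v, 𝟙 v⟩)
          rw [← hs ⟨v, v, 𝟙 v⟩]
          exact this
        rw [this]
      map_comp := fun {a b c} f f' => by
        apply RG.Admissible.hom_of_arr_eq
        rw [hm, ← Arr.comp_mk]
        refine hβ (g a) (hs _) rfl ?_
        rw [he, ← Arr.comp_mk, amap_comp, amap_comp]
        exact Arr.comp_congr (by rw [hm, he]) (by rw [hm, he]) _ _ }
  refine ⟨⟨F, fun {v w} f => ?_⟩, hom_ext_amap fun f => ?_, fun v => rfl⟩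
  · exact (congrArg S.d (hm f)).trans (hd _)
  · exact (congrArg (amap β) (hm f.hom)).trans (he f)

/-! ### Coverings, and morphisms of representation `k`-graphs as coverings -/

theorem IsCovering.comp {Ω Δ Λ : KGraph.{u} k} {τ : Ω ⟶ Δ} {α : Δ ⟶ Λ} (hτ : IsCovering τ)
    (hα : IsCovering α) : IsCovering (τ ≫ α) :=
  ⟨fun v => (hα.1 (vmap τ v)).comp (hτ.1 v), fun v => (hα.2 (vmap τ v)).comp (hτ.2 v)⟩

/-- The image is nonempty and closed under moving along paths in either direction, and `Λ` is
connected. -/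
theorem IsCovering.vmap_surjective {Ω Λ : KGraph.{u} k} {α : Ω ⟶ Λ} (hα : IsCovering α) :
    Function.Surjective (vmap α) := by
  intro v
  obtain ⟨w⟩ := Ω.nonempty
  have h := Λ.connected (vmap α w) v
  induction h with
  | refl => exact ⟨w, rfl⟩
  | tail _ h ih =>
    obtain ⟨x, rfl⟩ := ih
    obtain ⟨⟨f⟩⟩ | ⟨⟨f⟩⟩ := h
    · obtain ⟨g, -, hg⟩ := (hα.1 x).surjOn (a := ⟨_, _, f⟩) rfl
      exact ⟨g.tgt, congrArg Arr.tgt hg⟩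
    · obtain ⟨g, -, hg⟩ := (hα.2 x).surjOn (a := ⟨_, _, f⟩) rfl
      exact ⟨g.src, congrArg Arr.src hg⟩

/-- A morphism of representation `k`-graphs is a covering. -/
theorem RG.Hom.isCovering {Λ : KGraph.{u} k} {X Y : RG Λ} (φ : X ⟶ Y) :
    IsCovering φ.toHom := by
  have hα : ∀ f, amap Y.map (amap φ.toHom f) = amap X.map f := fun f => by
    rw [← amap_comp_apply, φ.comm]
  have hv : ∀ v, vmap Y.map (vmap φ.toHom v) = vmap X.map v := fun v => by
    rw [← vmap_comp_apply, φ.comm]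
  refine ⟨fun v => ⟨?_, ?_, ?_⟩, fun v => ⟨?_, ?_, ?_⟩⟩
  · rintro f rfl; rfl
  · intro f hf g hg h
    exact (X.isRep.1 v).injOn hf hg (by rw [← hα, h, hα])
  · intro y hy
    obtain ⟨f, hf, hfy⟩ := (X.isRep.1 v).surjOn
      (show (amap Y.map y).src = vmap X.map v from (congrArg (vmap Y.map) hy).trans (hv v))
    exact ⟨f, hf, (Y.isRep.1 _).injOn (congrArg (vmap φ.toHom) hf) hy ((hα f).trans hfy)⟩
  · rintro f rfl; rfl
  · intro f hf g hg h
    -- For incoming paths only degrees matter: on both sides there is exactly one path of each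
    -- degree into a given vertex, and `φ` preserves degrees.
    refine (X.isRep.2 v _).unique ⟨hf, rfl⟩ ⟨hg, ?_⟩
    rw [← d_amap φ.toHom, ← h, d_amap]
  · intro y hy
    obtain ⟨f, ⟨hf, hd⟩, -⟩ := X.isRep.2 v (Y.graph.d y)
    exact ⟨f, hf, (Y.isRep.2 _ _).unique ⟨congrArg (vmap φ.toHom) hf, (d_amap _ f).trans hd⟩
      ⟨hy, rfl⟩⟩

/-! ### Walks and coverings -/

theorem Edge.map_src {Λ Γ : KGraph.{u} k} (φ : Λ ⟶ Γ) (e : Edge Λ) :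
    (e.map φ).src = vmap φ e.src := by cases e <;> rfl

theorem Edge.map_tgt {Λ Γ : KGraph.{u} k} (φ : Λ ⟶ Γ) (e : Edge Λ) :
    (e.map φ).tgt = vmap φ e.tgt := by cases e <;> rfl

theorem Edge.map_map {T Λ Γ : KGraph.{u} k} (φ : T ⟶ Λ) (ψ : Λ ⟶ Γ) (e : Edge T) :
    (e.map φ).map ψ = e.map (φ ≫ ψ) := by cases e <;> rfl

theorem IsWalk.map {Λ Γ : KGraph.{u} k} (φ : Λ ⟶ Γ) {v w : Λ.Vert} {p : List (Edge Λ)}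
    (hp : IsWalk v p w) : IsWalk (vmap φ v) (p.map (Edge.map φ)) (vmap φ w) := by
  induction hp with
  | single e =>
    rw [← Edge.map_src, ← Edge.map_tgt]
    exact .single _
  | cons e _ ih =>
    rw [← Edge.map_tgt] at ih
    rw [← Edge.map_src]
    exact .cons _ ih

theorem IsCovering.exists_edge {Ω Λ : KGraph.{u} k} {α : Ω ⟶ Λ} (hα : IsCovering α)
    {v : Ω.Vert} {e : Edge Λ} (h : e.src = vmap α v) :
    ∃ e' : Edge Ω, e'.src = v ∧ e'.map α = e := by
  cases e with
  | fwd f =>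
    obtain ⟨g, hg, rfl⟩ := (hα.1 v).surjOn h
    exact ⟨.fwd g, hg, rfl⟩
  | bwd f hf =>
    obtain ⟨g, hg, rfl⟩ := (hα.2 v).surjOn h
    exact ⟨.bwd g fun h => hf ((isId_amap α g).2 h), hg, rfl⟩

/-- Walks lift along coverings. -/
theorem IsCovering.exists_walk {Ω Λ : KGraph.{u} k} {α : Ω ⟶ Λ} (hα : IsCovering α)
    {x y : Λ.Vert} {p : List (Edge Λ)} (hp : IsWalk x p y) {v : Ω.Vert} (hv : x = vmap α v) :
    ∃ q w, IsWalk v q w ∧ q.map (Edge.map α) = p := by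
  induction hp generalizing v with
  | single e =>
    obtain ⟨e', rfl, rfl⟩ := hα.exists_edge hv
    exact ⟨_, _, .single e', rfl⟩
  | cons e _ ih =>
    obtain ⟨e', rfl, rfl⟩ := hα.exists_edge hv
    obtain ⟨q, w, hq, rfl⟩ := ih (Edge.map_tgt α e')
    exact ⟨_, w, .cons e' hq, rfl⟩

/-- Walks from `vmap τ v` are exactly the images of walks from `v`, by walk lifting. Consequently
vertices in one fibre of a morphism of `RG Λ` are `∼`-equivalent. -/
theorem IsCovering.walkImage_comp {Ω Δ Λ : KGraph.{u} k} {τ : Ω ⟶ Δ} (hτ : IsCovering τ)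
    (α : Δ ⟶ Λ) (v : Ω.Vert) : walkImage (τ ≫ α) v = walkImage α (vmap τ v) := by
  have hmm : ∀ p : List (Edge Ω),
      (p.map (Edge.map τ)).map (Edge.map α) = p.map (Edge.map (τ ≫ α)) := fun p => by
    simp [Edge.map_map]
  ext r
  constructor
  · rintro ⟨p, w, hp, rfl⟩
    exact ⟨_, _, hp.map τ, hmm p⟩
  · rintro ⟨p, w, hp, rfl⟩
    obtain ⟨q, w, hq, rfl⟩ := hτ.exists_walk hp rfl
    exact ⟨q, w, hq, (hmm q).symm⟩

/-! ### Coverings from functors that turn every path into a bijection -/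

section elements

variable {Λ : KGraph.{u} k} (F : Λ.Vert ⥤ Type u)

/-- Bijectivity of `F.map f` is what determines the element over the source from the one over the
target. -/
theorem existsUnique_elements_tgt (hF : ∀ {v w : Λ.Vert} (f : v ⟶ w), IsIso (F.map f))
    (b : F.Elements) (f : Arr Λ.Vert) (h : f.tgt = b.1) :
    ∃! g : Arr F.Elements, g.tgt = b ∧ (⟨g.src.1, g.tgt.1, g.hom.1⟩ : Arr Λ.Vert) = f := by
  obtain ⟨v, w, f⟩ := f
  obtain ⟨c, y⟩ := b
  obtain rfl : w = c := h
  obtain ⟨hi, hs⟩ := (isIso_iff_bijective (F.map f)).1 (hF f)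
  obtain ⟨x, rfl⟩ := hs y
  refine ⟨⟨⟨v, x⟩, ⟨w, _⟩, ⟨f, rfl⟩⟩, ⟨rfl, rfl⟩, ?_⟩
  rintro ⟨⟨a, x'⟩, c, ⟨g, hg⟩⟩ ⟨rfl, hf⟩
  change a ⟶ w at g
  obtain rfl : a = v := congrArg Arr.src hf
  obtain rfl : g = f := RG.Admissible.hom_of_arr_eq hf
  have hx : x' = x := hi hg
  subst hx
  rfl

theorem existsUnique_elements_src (a : F.Elements) (f : Arr Λ.Vert) (h : f.src = a.1) :
    ∃! g : Arr F.Elements, g.src = a ∧ (⟨g.src.1, g.tgt.1, g.hom.1⟩ : Arr Λ.Vert) = f := by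
  obtain ⟨v, w, f⟩ := f
  obtain ⟨c, x⟩ := a
  obtain rfl : v = c := h
  refine ⟨⟨⟨v, x⟩, ⟨w, F.map f x⟩, ⟨f, rfl⟩⟩, ⟨rfl, rfl⟩, ?_⟩
  rintro ⟨a, ⟨b, y⟩, ⟨g, hg⟩⟩ ⟨rfl, hf⟩
  change v ⟶ b at g
  change F.map g x = y at hg
  obtain rfl : b = w := congrArg Arr.tgt hf
  obtain rfl : g = f := RG.Admissible.hom_of_arr_eq hf
  subst hg
  rfl

/-- The category of elements of a functor that maps all paths to bijections, as a `k`-graph. -/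
def elementsGraph (hF : ∀ {v w : Λ.Vert} (f : v ⟶ w), IsIso (F.map f))
    (hne : Nonempty F.Elements) (hconn : ∀ a b : F.Elements, Zigzag a b) : KGraph.{u} k where
  Vert := F.Elements
  deg {_ _} f := Λ.deg (Subtype.val f)
  deg_id a := Λ.deg_id (Sigma.fst a)
  deg_comp f g := Λ.deg_comp (Subtype.val f) (Subtype.val g)
  factor {a c} f m n h := by
    obtain ⟨v, x⟩ := a
    obtain ⟨w, z⟩ := c
    obtain ⟨f, hf⟩ := f
    obtain ⟨⟨b, p, q⟩, ⟨hq, hp, hpq⟩, hu⟩ := Λ.factor f m n h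
    dsimp only at hp hq hpq f
    -- The factorisation in `Λ` lifts uniquely, since the element over the middle vertex must be
    -- `F.map p x`.
    refine ⟨⟨⟨b, F.map p x⟩, ⟨p, rfl⟩, ⟨q, ?_⟩⟩, ⟨hq, hp, Subtype.ext hpq⟩, ?_⟩
    · dsimp only at hf ⊢
      rw [← hf, ← hpq, F.map_comp]
      rfl
    · rintro ⟨⟨b', y⟩, ⟨p', hp'⟩, ⟨q', hq'⟩⟩ ⟨h₁, h₂, h₃⟩
      change v ⟶ b' at p'
      change b' ⟶ w at q'
      change F.map p' x = y at hp'
      have e := hu ⟨b', p', q'⟩ ⟨h₁, h₂, congrArg Subtype.val h₃⟩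
      obtain rfl : b' = b := congrArg Sigma.fst e
      simp only [Sigma.mk.injEq, heq_eq_eq, Prod.mk.injEq, true_and] at e
      obtain ⟨rfl, rfl⟩ := e
      subst hp'
      rfl
  nonempty := hne
  connected := hconn
  rowFinite b n := by
    -- Projection to `Λ` is injective on paths into `b`, so finiteness is inherited.
    refine Set.Finite.of_injOn (f := fun g : Arr F.Elements =>
      (⟨g.src.1, g.tgt.1, g.hom.1⟩ : Arr Λ.Vert)) ?_ ?_ (Λ.rowFinite b.1 n)
    · rintro g ⟨rfl, h⟩
      exact ⟨rfl, h⟩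
    · rintro g ⟨hg, -⟩ g' ⟨hg', -⟩ h
      exact (existsUnique_elements_tgt F hF b _ (congrArg Sigma.fst hg)).unique ⟨hg, rfl⟩
        ⟨hg', h.symm⟩
  noSources b n := by
    obtain ⟨f, hf, hd⟩ := Λ.noSources b.1 n
    obtain ⟨g, ⟨hg, rfl⟩, -⟩ := existsUnique_elements_tgt F hF b f hf
    exact ⟨g, hg, hd⟩

/-- The projection of the `k`-graph of elements. -/
def elementsProj (hF : ∀ {v w : Λ.Vert} (f : v ⟶ w), IsIso (F.map f))
    (hne : Nonempty F.Elements) (hconn : ∀ a b : F.Elements, Zigzag a b) :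
    elementsGraph F hF hne hconn ⟶ Λ where
  toFunctor := (CategoryOfElements.π F : F.Elements ⥤ Λ.Vert)
  deg_map _ := rfl

theorem isCovering_elementsProj (hF : ∀ {v w : Λ.Vert} (f : v ⟶ w), IsIso (F.map f))
    (hne : Nonempty F.Elements) (hconn : ∀ a b : F.Elements, Zigzag a b) :
    IsCovering (elementsProj F hF hne hconn) := by
  refine ⟨fun a => ⟨?_, ?_, ?_⟩, fun a => ⟨?_, ?_, ?_⟩⟩
  · rintro f rfl; rfl
  · intro f hf g hg h
    exact (existsUnique_elements_src F a _ (congrArg Sigma.fst hf)).unique ⟨hf, rfl⟩ ⟨hg, h.symm⟩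
  · intro f hf
    exact (existsUnique_elements_src F a f hf).exists
  · rintro f rfl; rfl
  · intro f hf g hg h
    exact (existsUnique_elements_tgt F hF a _ (congrArg Sigma.fst hf)).unique ⟨hf, rfl⟩
      ⟨hg, h.symm⟩
  · intro f hf
    exact (existsUnique_elements_tgt F hF a f hf).exists

end elements

/-! ### The fibre functor of a covering -/

section fiber

variable {S Λ : KGraph.{u} k} {β : S ⟶ Λ}

theorem IsCovering.existsUnique_lift (hβ : IsCovering β) {v w : Λ.Vert} (f : v ⟶ w)
    (s : {s : S.Vert // vmap β s = v}) :
    ∃! g : Arr S.Vert, g.src = s.1 ∧ amap β g = ⟨v, w, f⟩ := by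
  obtain ⟨g, hg, e⟩ := (hβ.1 s.1).surjOn (a := ⟨v, w, f⟩) s.2.symm
  exact ⟨g, ⟨hg, e⟩, fun g' h => (hβ.1 s.1).injOn h.1 hg (h.2.trans e.symm)⟩

/-- The lift of a path along a covering, with prescribed source. -/
noncomputable def IsCovering.lift (hβ : IsCovering β) {v w : Λ.Vert} (f : v ⟶ w)
    (s : {s : S.Vert // vmap β s = v}) : Arr S.Vert := (hβ.existsUnique_lift f s).choose

theorem IsCovering.lift_src (hβ : IsCovering β) {v w : Λ.Vert} (f : v ⟶ w)
    (s : {s : S.Vert // vmap β s = v}) : (hβ.lift f s).src = s.1 :=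
  (hβ.existsUnique_lift f s).choose_spec.1.1

theorem IsCovering.amap_lift (hβ : IsCovering β) {v w : Λ.Vert} (f : v ⟶ w)
    (s : {s : S.Vert // vmap β s = v}) : amap β (hβ.lift f s) = ⟨v, w, f⟩ :=
  (hβ.existsUnique_lift f s).choose_spec.1.2

theorem IsCovering.lift_eq (hβ : IsCovering β) {v w : Λ.Vert} {f : v ⟶ w}
    {s : {s : S.Vert // vmap β s = v}} {g : Arr S.Vert} (h : g.src = s.1)
    (e : amap β g = ⟨v, w, f⟩) : hβ.lift f s = g :=
  (hβ.existsUnique_lift f s).unique ⟨hβ.lift_src f s, hβ.amap_lift f s⟩ ⟨h, e⟩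

/-- The fibres of a covering, on which paths act by lifting. -/
noncomputable def IsCovering.fiber (hβ : IsCovering β) : Λ.Vert ⥤ Type u where
  obj v := {s : S.Vert // vmap β s = v}
  map f := TypeCat.ofHom fun s => ⟨(hβ.lift f s).tgt, congrArg Arr.tgt (hβ.amap_lift f s)⟩
  map_id v := by
    ext ⟨s, rfl⟩
    exact congrArg Arr.tgt (hβ.lift_eq (g := ⟨s, s, 𝟙 s⟩) rfl (amap_id β s))
  map_comp {a b c} f f' := by
    ext s
    change (hβ.lift (f ≫ f') s).tgt = (hβ.lift f' ⟨(hβ.lift f s).tgt, _⟩).tgt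
    have hc : (hβ.lift f s).tgt =
        (hβ.lift f' ⟨(hβ.lift f s).tgt, congrArg Arr.tgt (hβ.amap_lift f s)⟩).src :=
      (hβ.lift_src f' ⟨(hβ.lift f s).tgt, congrArg Arr.tgt (hβ.amap_lift f s)⟩).symm
    -- The composite of the two lifts has the source and the image that characterise the lift of the
    -- composite.
    have key : hβ.lift (f ≫ f') s = (hβ.lift f s).comp _ hc := by
      refine hβ.lift_eq (hβ.lift_src f s) ?_
      rw [amap_comp, ← Arr.comp_mk]
      exact Arr.comp_congr (hβ.amap_lift f s) (hβ.amap_lift f' _) _ _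
    rw [key]
    rfl

/-- The inverse lifts `f` with prescribed target, using the bijection on incoming paths. -/
theorem IsCovering.isIso_fiber_map (hβ : IsCovering β) {v w : Λ.Vert} (f : v ⟶ w) :
    IsIso (hβ.fiber.map f) := by
  rw [isIso_iff_bijective]
  constructor
  · intro s t h
    have h' : (hβ.lift f s).tgt = (hβ.lift f t).tgt := congrArg Subtype.val h
    have := (hβ.2 _).injOn h' rfl ((hβ.amap_lift f s).trans (hβ.amap_lift f t).symm)
    exact Subtype.ext ((hβ.lift_src f s).symm.trans ((congrArg Arr.src this).trans
      (hβ.lift_src f t)))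
  · rintro ⟨t, rfl⟩
    obtain ⟨g, rfl, e⟩ := (hβ.2 t).surjOn (a := ⟨v, _, f⟩) rfl
    exact ⟨⟨g.src, congrArg Arr.src e⟩, Subtype.ext (congrArg Arr.tgt (hβ.lift_eq rfl e))⟩

end fiber

/-! ### Existence of universal coverings -/

section universalCovering

variable (Λ : KGraph.{u} k) (v₀ : Λ.Vert)

/-- The homotopy classes of walks starting in `v₀`. -/
noncomputable def homotopyFunctor : Λ.Vert ⥤ Type u :=
  FreeGroupoid.of Λ.Vert ⋙ coyoneda.obj (Opposite.op ((FreeGroupoid.of Λ.Vert).obj v₀))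

theorem isIso_homotopyFunctor_map {v w : Λ.Vert} (f : v ⟶ w) :
    IsIso ((homotopyFunctor Λ v₀).map f) := by
  unfold homotopyFunctor
  rw [Functor.comp_map]
  infer_instance

/-- A morphism out of `v₀` in the free groupoid is a composite of paths and inverses of paths; each
factor contributes one step of a zigzag between elements. -/
theorem zigzag_homotopyFunctor (a : (homotopyFunctor Λ v₀).Elements) :
    Zigzag (J := (homotopyFunctor Λ v₀).Elements)
      ⟨v₀, 𝟙 ((FreeGroupoid.of Λ.Vert).obj v₀)⟩ a := by
  let P : StructuredArrow ((FreeGroupoid.of Λ.Vert).obj v₀) (FreeGroupoid.of Λ.Vert) → Prop :=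
    fun g => Zigzag (J := (homotopyFunctor Λ v₀).Elements)
      ⟨v₀, 𝟙 ((FreeGroupoid.of Λ.Vert).obj v₀)⟩ ⟨g.right, g.hom⟩
  refine Localization.induction_structuredArrow (FreeGroupoid.of Λ.Vert) ⊤ P (Zigzag.refl _)
    (fun v w f φ h => h.trans (Zigzag.of_hom ⟨f, rfl⟩))
    (fun v w f hf φ h => h.trans (Zigzag.of_inv ⟨f, ?_⟩)) (StructuredArrow.mk a.2)
  change (φ ≫ (Localization.isoOfHom (FreeGroupoid.of Λ.Vert) ⊤ f hf).inv) ≫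
    (FreeGroupoid.of Λ.Vert).map f = φ
  rw [Category.assoc, Localization.isoOfHom_inv_hom_id, Category.comp_id]

/-- Every `k`-graph has a universal covering. -/
theorem exists_isUniversalCovering :
    ∃ (Ω : KGraph.{u} k) (τ : Ω ⟶ Λ), IsUniversalCovering τ := by
  obtain ⟨v₀⟩ := Λ.nonempty
  have hF : ∀ {v w : Λ.Vert} (f : v ⟶ w), IsIso ((homotopyFunctor Λ v₀).map f) :=
    isIso_homotopyFunctor_map Λ v₀
  have hne : Nonempty (homotopyFunctor Λ v₀).Elements :=
    ⟨⟨v₀, 𝟙 ((FreeGroupoid.of Λ.Vert).obj v₀)⟩⟩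
  have hconn : ∀ a b : (homotopyFunctor Λ v₀).Elements, Zigzag a b := fun a b =>
    (zigzag_homotopyFunctor Λ v₀ a).symm.trans (zigzag_homotopyFunctor Λ v₀ b)
  refine ⟨_, elementsProj _ hF hne hconn, isCovering_elementsProj _ hF hne hconn,
    fun S β hβ => ?_⟩
  obtain ⟨s₀, hs₀⟩ := hβ.vmap_surjective v₀
  -- The fibre functor inverts all paths, so it factors through the free groupoid, which is the
  -- localization at all morphisms.
  have hinv : (⊤ : MorphismProperty Λ.Vert).IsInvertedBy hβ.fiber :=
    fun _ _ f _ => hβ.isIso_fiber_map f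
  let e := Localization.fac hβ.fiber hinv (FreeGroupoid.of Λ.Vert)
  -- Yoneda: the base point `s₀` over `v₀` determines a natural transformation out of the
  -- representable functor. On elements it sends a class of walks to the endpoint of its lift from
  -- `s₀`.
  let N : homotopyFunctor Λ v₀ ⟶ hβ.fiber :=
    Functor.whiskerLeft (FreeGroupoid.of Λ.Vert)
      (coyonedaEquiv.symm (e.inv.app v₀ (⟨s₀, hs₀⟩ : hβ.fiber.obj v₀))) ≫ e.hom
  obtain ⟨φ, hφ, -⟩ := exists_hom_of_vertexMap (elementsProj _ hF hne hconn) β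
    (fun v => (hβ.1 v).injOn) (fun a => (N.app (Sigma.fst a) (Sigma.snd a)).1) (fun f => by
      obtain ⟨⟨v, x⟩, ⟨w, y⟩, ⟨f, hf⟩⟩ := f
      change v ⟶ w at f
      change (homotopyFunctor Λ v₀).map f x = y at hf
      subst hf
      refine ⟨hβ.lift f (N.app v x), hβ.lift_src _ _, ?_, hβ.amap_lift _ _⟩
      exact congrArg Subtype.val (NatTrans.naturality_apply N f x).symm)
  exact ⟨φ, hφ⟩

end universalCovering

/-! ### Connected components of `RG Λ` and the attracting object -/

section component

variable {Λ : KGraph.{u} k}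

/-- The quotient morphism `(Δ, α) → (Δ_∼, α_∼)`. -/
theorem RG.nonempty_hom_simQuot (X : RG Λ) : Nonempty (X ⟶ X.simQuot) := by
  obtain ⟨φ, hφ, -⟩ := exists_hom_of_vertexMap X.map X.simQuot.map
    (fun v => (X.simQuot.isRep.1 v).injOn) X.sim_admissible.qv
    (fun f => ⟨⟨_, _, X.sim_admissible.qhom f⟩, rfl, rfl, X.sim_admissible.amap_qmap _⟩)
  exact ⟨⟨φ, hφ⟩⟩

/-- If `Z` is covered by `X`, there is a morphism from `Z` to `X_∼`. -/
theorem RG.nonempty_hom_simQuot_of_hom {X Z : RG Λ} (μ : X ⟶ Z) :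
    Nonempty (Z ⟶ X.simQuot) := by
  have hμ := RG.Hom.isCovering μ
  -- Preimages may be chosen arbitrarily, since each fibre of `μ` lies in one `∼`-class.
  choose l hl using hμ.vmap_surjective
  obtain ⟨φ, hφ, -⟩ := exists_hom_of_vertexMap Z.map X.simQuot.map
    (fun v => (X.simQuot.isRep.1 v).injOn) (fun z => X.sim_admissible.qv (l z)) (fun f => by
      -- The lift `g` need not end at the chosen preimage of the target of `f`, but both lie over
      -- that target, so their classes agree.
      obtain ⟨g, hg, rfl⟩ := (hμ.1 (l f.src)).surjOn (a := f) (hl _).symm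
      refine ⟨⟨_, _, X.sim_admissible.qhom g⟩, congrArg _ hg, X.sim_admissible.qv_eq.2 ?_, ?_⟩
      · change walkImage X.map _ = walkImage X.map _
        rw [← μ.comm, hμ.walkImage_comp, hμ.walkImage_comp, hl]
        rfl
      · refine (X.sim_admissible.amap_qmap _).trans ?_
        rw [← amap_comp_apply, μ.comm]
        rfl)
  exact ⟨⟨φ, hφ⟩⟩

/-- A universal covering of one object of a connected component of `RG(Λ)` maps to all objects
of the component. -/
theorem RG.nonempty_hom_of_zigzag {X Y : RG Λ} {Ω : KGraph.{u} k} {τ : Ω ⟶ X.graph}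
    (hτ : IsUniversalCovering τ) (h : Zigzag X Y) : Nonempty (X.pullback τ hτ.1 ⟶ Y) := by
  induction h with
  | refl => exact ⟨⟨τ, rfl⟩⟩
  | @tail Y Z _ h ih =>
    obtain ⟨μ⟩ := ih
    obtain ⟨⟨ν⟩⟩ | ⟨⟨ν⟩⟩ := h
    · exact ⟨μ ≫ ν⟩
    -- Here `ν : Z ⟶ Y` points the wrong way. Both `μ` and `ν` are coverings of `Y`, so its
    -- universal covering `U` maps to each of their domains.
    · obtain ⟨U, υ, hυ⟩ := exists_isUniversalCovering Y.graph
      obtain ⟨σ, hσ⟩ := hυ.2 _ μ.toHom (RG.Hom.isCovering μ)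
      obtain ⟨ρ, hρ⟩ := hυ.2 _ ν.toHom (RG.Hom.isCovering ν)
      let σ' : Y.pullback υ hυ.1 ⟶ X.pullback τ hτ.1 :=
        ⟨σ, (congrArg (σ ≫ ·) μ.comm.symm).trans (congrArg (· ≫ Y.map) hσ)⟩
      let ρ' : Y.pullback υ hυ.1 ⟶ Z :=
        ⟨ρ, (congrArg (ρ ≫ ·) ν.comm.symm).trans (congrArg (· ≫ Y.map) hρ)⟩
      -- As a morphism of `RG Λ`, `σ` is a covering, which makes `U` a covering of `X` through `σ ≫
      -- τ`. Universality of `τ` then gives a morphism from `Ω` back to `U`.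
      obtain ⟨κ, hκ⟩ := hτ.2 _ (σ ≫ τ) ((RG.Hom.isCovering σ').comp hτ.1)
      let κ' : X.pullback τ hτ.1 ⟶ Y.pullback υ hυ.1 := 
        ⟨κ, (congrArg (κ ≫ ·) σ'.comm.symm).trans (congrArg (· ≫ X.map) hκ)⟩
      exact ⟨κ' ≫ ρ'⟩

theorem objectProperty_of_hom {J : Type*} [Category J] {C : ConnectedComponents J} {X Y : J}
    (f : X ⟶ Y) : C.objectProperty X ↔ C.objectProperty Y := by
  have h : (Quotient.mk'' X : ConnectedComponents J) = Quotient.mk'' Y :=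
    Quotient.sound' (Zigzag.of_hom f)
  change (Quotient.mk'' X : ConnectedComponents J) = C ↔ Quotient.mk'' Y = C
  rw [h]

end component
end HRG

theorem theorem3p12 (k : ℕ) (hk : 0 < k) (Λ : HRG.KGraph.{u} k)
    (C : ConnectedComponents (HRG.RG Λ)) :
    (∃ X : HRG.RG Λ, C.objectProperty X) ∧
    (∀ X : HRG.RG Λ, C.objectProperty X →
      ∃ (Ω : HRG.KGraph.{u} k) (τ : Ω ⟶ X.graph), HRG.IsUniversalCovering τ) ∧
    (∀ X : HRG.RG Λ, C.objectProperty X →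
      ∀ (Ω : HRG.KGraph.{u} k) (τ : Ω ⟶ X.graph) (hτ : HRG.IsUniversalCovering τ),
        C.objectProperty (X.pullback τ hτ.1) ∧
        (∃ h : C.objectProperty (X.pullback τ hτ.1).simQuot,
          HRG.IsAttracting (C := C.Component) ⟨(X.pullback τ hτ.1).simQuot, h⟩) ∧
        ∀ (S : HRG.KGraph.{u} k) (γ : S ⟶ Λ),
          (∃ h : HRG.IsRep γ, C.objectProperty ⟨S, γ, h⟩) ↔
          ∃ η : S ⟶ (X.pullback τ hτ.1).simQuot.graph,
            HRG.IsCovering η ∧ γ = η ≫ (X.pullback τ hτ.1).simQuot.map) := by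
  refine ⟨Quotient.inductionOn' C fun X => ⟨X, rfl⟩,
    fun X _ => HRG.exists_isUniversalCovering X.graph, fun X hX Ω τ hτ => ?_⟩
  let τ' : X.pullback τ hτ.1 ⟶ X := ⟨τ, rfl⟩
  have hΩ : C.objectProperty (X.pullback τ hτ.1) := (HRG.objectProperty_of_hom τ').2 hX
  obtain ⟨π⟩ := (X.pullback τ hτ.1).nonempty_hom_simQuot
  have hΓ : C.objectProperty (X.pullback τ hτ.1).simQuot := (HRG.objectProperty_of_hom π).1 hΩ
  have hatt : ∀ Y : HRG.RG Λ, C.objectProperty Y →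
      Nonempty (Y ⟶ (X.pullback τ hτ.1).simQuot) := fun Y hY => by
    obtain ⟨μ⟩ := HRG.RG.nonempty_hom_of_zigzag hτ
      (Quotient.exact' (hX.trans hY.symm) : Zigzag X Y)
    exact HRG.RG.nonempty_hom_simQuot_of_hom μ
  refine ⟨hΩ, ⟨hΓ, fun Y => ?_⟩, fun S γ => ⟨?_, ?_⟩⟩
  · obtain ⟨φ⟩ := hatt Y.obj Y.property
    exact ⟨ObjectProperty.homMk φ⟩
  · rintro ⟨h, hS⟩
    obtain ⟨φ⟩ := hatt _ hS
    exact ⟨φ.toHom, HRG.RG.Hom.isCovering φ, φ.comm.symm⟩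
  · rintro ⟨η, hη, rfl⟩
    -- The covering `η` is itself a morphism of `RG Λ`, which places its domain in the component
    -- `C`.
    let φ : (⟨S, _, (X.pullback τ hτ.1).simQuot.isRep.comp_covering hη⟩ : HRG.RG Λ) ⟶
      (X.pullback τ hτ.1).simQuot := ⟨η, rfl⟩
    exact ⟨_, (HRG.objectProperty_of_hom φ).2 hΓ⟩
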